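/- **Theorem 3.1.** All rings are commutative with identity. Let $k$ be a field, and let $A$ and $B$ be preadic noetherian $k$-algebras with ideals of definition $\mathfrak a\subseteq A$ and $\mathfrak b\subseteq B$; that is, $A$ and $B$ are noetherian and carry the $\mathfrak a$-adic and the $\mathfrak b$-adic topology respectively (not assumed separated or complete). Let $E=A\hat\otimes_k B$ be the completed tensor product, i.e. the separated completion of $A\otimes_k B$ for the topology defined by the ideals $\mathfrak a^i(A\otimes_k B)+\mathfrak b^j(A\otimes_k B)$, equivalently the completion of $A\otimes_k B$ with respect to the ideal $\mathfrak a(A\otimes_k B)+\mathfrak b(A\otimes_k B)$. Suppose that $E$ is noetherian. Then: (i) The canonical homomorphism $A\to E$ is flat. (ii) If $A\to E$ is faithfully flat, then $A$ is a Zariski ring, i.e. a noetherian ring whose topology is defined by an ideal of definition contained in its Jacobson radical. Conversely, if $A$ is a Zariski ring and $\mathfrak b\neq B$, then $A\to E$ is faithfully flat. In particular, when $\mathfrak b\ne B$, the homomorphism $A\to E$ is faithfully flat if and only if $A$ is a Zariski ring. (iii) For every ideal $\mathfrak a'$ of $A$ containing $\mathfrak a$, the canonical homomorphism $B\to E/\mathfrak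 a'E$ is flat. -/

import Mathlib

open scoped TensorProduct

/-- A Zariski ring: a noetherian ring, topologized by the powers of an ideal of definition
(`IsAdic J`: the given topology is the `J`-adic one, not necessarily separated or complete)
which is contained in the Jacobson radical. -/
def IsZariskiRing (A : Type*) [CommRing A] [TopologicalSpace A] : Prop :=
  IsNoetherianRing A ∧ ∃ J : Ideal A, IsAdic J ∧ J ≤ Ideal.jacobson (⊥ : Ideal A)

namespace CompletedTensorProduct

variable (k : Type*) {A B : Type*} [CommRing k] [CommRing A] [CommRing B]
  [Algebra k A] [Algebra k B]

/-- The extension `𝔞 (A ⊗ B)` of an ideal of the left factor. -/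
def extendLeft (B : Type*) [CommRing B] [Algebra k B] (𝔞 : Ideal A) : Ideal (A ⊗[k] B) :=
  𝔞.map (Algebra.TensorProduct.includeLeft : A →ₐ[k] A ⊗[k] B)

/-- The extension `𝔟 (A ⊗ B)` of an ideal of the right factor. -/
def extendRight (A : Type*) [CommRing A] [Algebra k A] (𝔟 : Ideal B) : Ideal (A ⊗[k] B) :=
  𝔟.map (Algebra.TensorProduct.includeRight : B →ₐ[k] A ⊗[k] B)

/-- The ideal `𝔯 = 𝔞 (A ⊗ B) + 𝔟 (A ⊗ B)`, which is an ideal of definition of the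
tensor product topology, see `hasBasis_nhds_zero`. -/
def tensorIdeal (𝔞 : Ideal A) (𝔟 : Ideal B) : Ideal (A ⊗[k] B) :=
  extendLeft k B 𝔞 ⊔ extendRight k A 𝔟

/-- The `𝔯`-adic topology is the tensor product topology: the ideals
`𝔞 ^ i (A ⊗ B) + 𝔟 ^ j (A ⊗ B)` form a basis of neighbourhoods of zero. -/
theorem hasBasis_nhds_zero (𝔞 : Ideal A) (𝔟 : Ideal B) :
    (@nhds (A ⊗[k] B) (tensorIdeal k 𝔞 𝔟).adicTopology 0).HasBasis (fun _ : ℕ × ℕ => True)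
      (fun p => ((extendLeft k B (𝔞 ^ p.1) ⊔ extendRight k A (𝔟 ^ p.2) :
        Ideal (A ⊗[k] B)) : Set (A ⊗[k] B))) := by
  refine (Ideal.hasBasis_nhds_zero_adic (tensorIdeal k 𝔞 𝔟)).to_hasBasis ?_ ?_
  · intro n _
    refine ⟨(n, n), trivial, ?_⟩
    simp only [SetLike.coe_subset_coe, extendLeft, extendRight, tensorIdeal, Ideal.map_pow]
    exact sup_le (Ideal.pow_right_mono le_sup_left n) (Ideal.pow_right_mono le_sup_right n)
  · rintro ⟨i, j⟩ _
    refine ⟨i + j, trivial, ?_⟩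
    simp only [SetLike.coe_subset_coe, extendLeft, extendRight, tensorIdeal, Ideal.map_pow]
    exact Ideal.sup_pow_add_le_pow_sup_pow

end CompletedTensorProduct

open CompletedTensorProduct in
/-- The completed tensor product of `A` and `B` over `k`, for the `𝔞`-adic topology on `A` and the
`𝔟`-adic topology on `B`: the separated completion of `A ⊗ B` for the tensor product topology. -/
abbrev CompletedTensorProduct (k : Type*) {A B : Type*} [CommRing k] [CommRing A] [CommRing B]
    [Algebra k A] [Algebra k B] (𝔞 : Ideal A) (𝔟 : Ideal B) : Type _ :=
  AdicCompletion (tensorIdeal k 𝔞 𝔟) (A ⊗[k] B)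

namespace CompletedTensorProduct

variable (k : Type*) {A B : Type*} [CommRing k] [CommRing A] [CommRing B]
  [Algebra k A] [Algebra k B]

/-- The canonical homomorphism from `A ⊗ B` to its completion. -/
noncomputable def ofTensor (𝔞 : Ideal A) (𝔟 : Ideal B) :
    A ⊗[k] B →+* CompletedTensorProduct k 𝔞 𝔟 :=
  algebraMap (A ⊗[k] B) (AdicCompletion (tensorIdeal k 𝔞 𝔟) (A ⊗[k] B))

/-- The canonical homomorphism from `A` to the completed tensor product. -/
noncomputable def inl (𝔞 : Ideal A) (𝔟 : Ideal B) : A →+* CompletedTensorProduct k 𝔞 𝔟 :=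
  (ofTensor k 𝔞 𝔟).comp (Algebra.TensorProduct.includeLeft : A →ₐ[k] A ⊗[k] B).toRingHom

/-- The canonical homomorphism from `B` to the completed tensor product. -/
noncomputable def inr (𝔞 : Ideal A) (𝔟 : Ideal B) : B →+* CompletedTensorProduct k 𝔞 𝔟 :=
  (ofTensor k 𝔞 𝔟).comp (Algebra.TensorProduct.includeRight : B →ₐ[k] A ⊗[k] B).toRingHom

end CompletedTensorProduct

/-! Over a field, `A ⧸ 𝔞 ^ n ⊗ B ⧸ 𝔟 ^ n` is flat over `A ⧸ 𝔞 ^ n`, and `E` maps onto it with kernel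
`𝔞 ^ n E + 𝔟 ^ n E`. Flatness passes to `E` by a local criterion: a relation in `E` becomes trivial
in such a quotient, so an element of the kernel of `E ⊗ I → E` is zero up to errors that Artin–Rees
makes arbitrarily small, and Krull's intersection theorem makes it vanish. The same criterion,
applied to `E ⧸ 𝔞'E` and the quotients `A ⧸ 𝔞' ⊗ B ⧸ 𝔟 ^ n`, gives (iii). For (ii), `𝔞E` lies in the
Jacobson radical of `E`, and an open maximal ideal `𝔪` survives in the nonzero quotient `A ⧸ 𝔪 ⊗ B ⧸
𝔟`. -/

/-- Flatness from flat approximations: if `F` is a noetherian `A`-algebra, separated for an ideal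
`ρ ⊇ 𝔞 F` in its Jacobson radical, and `F` maps onto flat `A ⧸ 𝔞 ^ n`-algebras with kernels
inside `ρ ^ n`, then `F` is flat over `A`. -/
theorem RingHom.Flat.of_flat_approximations {A F : Type*} [CommRing A] [CommRing F]
    [IsNoetherianRing A] [IsNoetherianRing F] (φ : A →+* F) (𝔞 : Ideal A) (ρ : Ideal F)
    (hρ : ρ ≤ Ideal.jacobson ⊥) (h𝔞 : 𝔞.map φ ≤ ρ)
    {T : ℕ → Type*} [∀ n, CommRing (T n)] (π : ∀ n, F →+* T n)
    (hπ : ∀ n, Function.Surjective (π n)) (hker : ∀ n, RingHom.ker (π n) ≤ ρ ^ n)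
    (g : ∀ n, A ⧸ 𝔞 ^ n →+* T n) (hg : ∀ n, (g n).Flat)
    (hgπ : ∀ n a, g n (Ideal.Quotient.mk _ a) = π n (φ a)) : φ.Flat := by
  algebraize [φ]
  change Module.Flat A F
  refine ((Module.Flat.tfae_equational_criterion A F).out 0 1).mpr fun I => ?_
  rw [← LinearMap.lTensor_inj_iff_rTensor_inj, injective_iff_map_eq_zero]
  intro x hx
  have hbot : (⨅ n : ℕ, ρ ^ n • ⊤ : Submodule F (F ⊗[A] I)) = ⊥ :=
    Ideal.iInf_pow_smul_eq_bot_of_le_jacobson _ hρ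
  rw [← Submodule.mem_bot F, ← hbot, Submodule.mem_iInf]
  intro n
  obtain ⟨c, hc⟩ := Ideal.exists_pow_inf_eq_pow_smul 𝔞 (M := A) I
  -- elements of `𝔞 ^ (n + c) ⊓ I` have images in `ρ ^ n (F ⊗ I)`
  have key : ∀ z : I, (z : A) ∈ 𝔞 ^ (n + c) → ∀ y : F,
      y ⊗ₜ[A] z ∈ (ρ ^ n • ⊤ : Submodule F (F ⊗[A] I)) := by
    intro z hz y
    have hmem : (z : A) ∈ 𝔞 ^ n • I := by
      have h1 : (z : A) ∈ 𝔞 ^ (n + c) • (⊤ : Submodule A A) ⊓ I := ⟨by simpa using hz, z.2⟩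
      rw [hc (n + c) (Nat.le_add_left c n), Nat.add_sub_cancel] at h1
      exact Submodule.smul_mono le_rfl inf_le_right h1
    have hmem' : z ∈ 𝔞 ^ n • (⊤ : Submodule A I) := by
      have hmap : (𝔞 ^ n • (⊤ : Submodule A I)).map I.subtype = 𝔞 ^ n • I := by
        rw [Submodule.map_smul'', Submodule.map_top, Submodule.range_subtype]
      obtain ⟨w, hw, hwz⟩ := Submodule.mem_map.mp (hmap.ge hmem)
      rwa [← Subtype.ext (a1 := w) (a2 := z) hwz]
    refine Submodule.smul_induction_on hmem' (fun r hr m _ => ?_) (fun u v hu hv => ?_)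
    · rw [← TensorProduct.smul_tmul, Algebra.smul_def, ← smul_eq_mul, ← TensorProduct.smul_tmul']
      refine Submodule.smul_mem_smul ?_ trivial
      exact (Ideal.pow_right_mono h𝔞 n) (by
        rw [← Ideal.map_pow]; exact Ideal.mem_map_of_mem _ hr)
    · rw [TensorProduct.tmul_add]
      exact add_mem hu hv
  obtain ⟨S, rfl⟩ := TensorProduct.exists_finset x
  -- The Artin–Rees constant `c` is the precision lost in passing from `𝔞 ^ N ⊓ I` to `𝔞 ^ n • I`.
  set N := n + c with hN
  have hsum : ∑ i : S, φ (i.1.2 : A) * i.1.1 = 0 := by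
    have := congrArg (TensorProduct.rid A F) hx
    simp only [map_sum, LinearMap.lTensor_tmul, TensorProduct.rid_tmul, map_zero,
      Submodule.subtype_apply] at this
    rw [Finset.sum_coe_sort S (fun i => φ (i.2 : A) * i.1), ← this]
    exact Finset.sum_congr rfl fun i _ => (Algebra.smul_def _ _).symm
  algebraize [g N]
  have hflat : Module.Flat (A ⧸ 𝔞 ^ N) (T N) := hg N
  obtain ⟨l, p, y, hy, hp⟩ := Module.Flat.isTrivialRelation_of_sum_smul_eq_zero
    (f := fun i : S => Ideal.Quotient.mk (𝔞 ^ N) (i.1.2 : A)) (x := fun i : S => π N i.1.1) (by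
      simp only [Algebra.smul_def, RingHom.algebraMap_toAlgebra, hgπ]
      simpa using congrArg (π N) hsum)
  choose p' hp' using fun i j => Ideal.Quotient.mk_surjective (p i j)
  choose y' hy' using fun j => hπ N (y j)
  have hrem : ∀ i : S, i.1.1 - ∑ j, φ (p' i j) * y' j ∈ ρ ^ n := by
    intro i
    refine Ideal.pow_le_pow_right (Nat.le_add_right n c) (hker N ?_)
    rw [RingHom.mem_ker, map_sub, sub_eq_zero, map_sum]
    refine (hy i).trans ?_
    refine Finset.sum_congr rfl fun j _ => ?_
    rw [map_mul, ← hgπ, hp', hy', Algebra.smul_def, RingHom.algebraMap_toAlgebra]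
  have hz : ∀ j, ((∑ i : S, p' i j • i.1.2 : I) : A) ∈ 𝔞 ^ N := by
    intro j
    rw [← Ideal.Quotient.eq_zero_iff_mem, ← hp j]
    simp [hp', mul_comm]
  -- Lifting the trivialization modulo `𝔞 ^ N` leaves two errors: one in the `F`-coefficients, one
  -- in the elements of `I`.
  have hx' : ∑ i ∈ S, i.1 ⊗ₜ[A] i.2 =
      ∑ i : S, (i.1.1 - ∑ j, φ (p' i j) * y' j) ⊗ₜ[A] i.1.2 +
        ∑ j, y' j ⊗ₜ[A] (∑ i : S, p' i j • i.1.2) := by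
    rw [← Finset.sum_coe_sort S (fun i => i.1 ⊗ₜ[A] i.2)]
    simp only [TensorProduct.sub_tmul, TensorProduct.sum_tmul, TensorProduct.tmul_sum,
      Finset.sum_sub_distrib]
    rw [Finset.sum_comm (s := (Finset.univ : Finset S)), eq_comm, sub_add_eq_add_sub,
      sub_eq_iff_eq_add]
    congr 1
    refine Finset.sum_congr rfl fun j _ => Finset.sum_congr rfl fun i _ => ?_
    rw [← TensorProduct.smul_tmul, Algebra.smul_def]
    rfl
  rw [hx']
  refine add_mem (sum_mem fun i _ => ?_) (sum_mem fun j _ => key _ (hz j) _)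
  rw [← mul_one (_ - _), ← smul_eq_mul, ← TensorProduct.smul_tmul']
  exact Submodule.smul_mem_smul (hrem i) trivial

/-! ### Faithful flatness and Zariski rings -/

theorem RingHom.FaithfullyFlat.of_flat_of_map_ne_top {A F : Type*} [CommRing A] [CommRing F]
    {φ : A →+* F} (hφ : φ.Flat) (h : ∀ 𝔪 : Ideal A, 𝔪.IsMaximal → 𝔪.map φ ≠ ⊤) :
    φ.FaithfullyFlat := by
  algebraize [φ]
  rw [← RingHom.algebraMap_toAlgebra φ, RingHom.faithfullyFlat_algebraMap_iff]
  refine ⟨fun {𝔪} h𝔪 htop => h 𝔪 h𝔪 ?_⟩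
  rwa [Ideal.smul_top_eq_map, Submodule.restrictScalars_eq_top_iff] at htop

/-- `J` is open, so it contains a power of `𝔞`; as `J ≤ 𝔪` and `𝔪` is prime, `𝔞` itself lies in `𝔪`.
-/
theorem IsZariskiRing.le_of_isMaximal {A : Type*} [CommRing A] [TopologicalSpace A]
    (hA : IsZariskiRing A) {𝔞 : Ideal A} (h𝔞 : IsAdic 𝔞) {𝔪 : Ideal A} (h𝔪 : 𝔪.IsMaximal) :
    𝔞 ≤ 𝔪 := by
  obtain ⟨-, J, hJ, hJjac⟩ := hA
  have hmem : (J : Set A) ∈ nhds (0 : A) := by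
    simpa using hJ.hasBasis_nhds_zero.mem_of_mem (i := 1) trivial
  obtain ⟨n, -, hn⟩ := h𝔞.hasBasis_nhds_zero.mem_iff.mp hmem
  exact h𝔪.isPrime.le_of_pow_le (n := n)
    ((SetLike.coe_subset_coe.mp hn).trans (hJjac.trans (sInf_le ⟨bot_le, h𝔪⟩)))

/-! ### Discrete quotients of the completed tensor product -/

namespace CompletedTensorProduct

variable (k : Type*) {A B : Type*} [Field k] [CommRing A] [CommRing B]
  [Algebra k A] [Algebra k B]

theorem tensorIdeal_fg [IsNoetherianRing A] [IsNoetherianRing B] (𝔞 : Ideal A) (𝔟 : Ideal B) :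
    (tensorIdeal k 𝔞 𝔟).FG :=
  Submodule.FG.sup (Ideal.FG.map (IsNoetherian.noetherian 𝔞) _)
    (Ideal.FG.map (IsNoetherian.noetherian 𝔟) _)

theorem map_ofTensor_extendLeft (𝔞 𝔠 : Ideal A) (𝔟 : Ideal B) :
    (extendLeft k B 𝔠).map (ofTensor k 𝔞 𝔟) = 𝔠.map (inl k 𝔞 𝔟) :=
  Ideal.map_map _ _

theorem map_ofTensor_extendRight (𝔞 : Ideal A) (𝔟 𝔡 : Ideal B) :
    (extendRight k A 𝔡).map (ofTensor k 𝔞 𝔟) = 𝔡.map (inr k 𝔞 𝔟) :=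
  Ideal.map_map _ _

theorem map_ofTensor_tensorIdeal (𝔞 𝔠 : Ideal A) (𝔟 𝔡 : Ideal B) :
    (tensorIdeal k 𝔠 𝔡).map (ofTensor k 𝔞 𝔟) = 𝔠.map (inl k 𝔞 𝔟) ⊔ 𝔡.map (inr k 𝔞 𝔟) := by
  rw [show tensorIdeal k 𝔠 𝔡 = extendLeft k B 𝔠 ⊔ extendRight k A 𝔡 from rfl, Ideal.map_sup, map_ofTensor_extendLeft, map_ofTensor_extendRight]

/-- The quotient map `A ⊗ B → A ⧸ 𝔠 ⊗ B ⧸ 𝔡`. -/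
noncomputable def tensorQuotient (𝔠 : Ideal A) (𝔡 : Ideal B) :
    A ⊗[k] B →ₐ[k] (A ⧸ 𝔠) ⊗[k] (B ⧸ 𝔡) :=
  Algebra.TensorProduct.map (Ideal.Quotient.mkₐ k 𝔠) (Ideal.Quotient.mkₐ k 𝔡)

theorem tensorQuotient_surjective (𝔠 : Ideal A) (𝔡 : Ideal B) :
    Function.Surjective (tensorQuotient k 𝔠 𝔡) :=
  TensorProduct.map_surjective (Ideal.Quotient.mkₐ_surjective k 𝔠)
    (Ideal.Quotient.mkₐ_surjective k 𝔡)

theorem ker_tensorQuotient (𝔠 : Ideal A) (𝔡 : Ideal B) :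
    RingHom.ker (tensorQuotient k 𝔠 𝔡) = tensorIdeal k 𝔠 𝔡 := by
  rw [tensorQuotient, Algebra.TensorProduct.map_ker _ _ (Ideal.Quotient.mkₐ_surjective k 𝔠)
    (Ideal.Quotient.mkₐ_surjective k 𝔡)]
  have h𝔠 : RingHom.ker (Ideal.Quotient.mkₐ k 𝔠) = 𝔠 := Ideal.Quotient.mkₐ_ker k 𝔠
  have h𝔡 : RingHom.ker (Ideal.Quotient.mkₐ k 𝔡) = 𝔡 := Ideal.Quotient.mkₐ_ker k 𝔡
  rw [h𝔠, h𝔡]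
  rfl

/-- The continuous extension `A ⊗̂ B → A ⧸ 𝔠 ⊗ B ⧸ 𝔡` of the quotient map, for open ideals. -/
noncomputable def toQuotient (𝔞 𝔠 : Ideal A) (𝔟 𝔡 : Ideal B) (m : ℕ)
    (h : tensorIdeal k 𝔞 𝔟 ^ m ≤ tensorIdeal k 𝔠 𝔡) :
    CompletedTensorProduct k 𝔞 𝔟 →+* (A ⧸ 𝔠) ⊗[k] (B ⧸ 𝔡) :=
  (Ideal.Quotient.lift _ (tensorQuotient k 𝔠 𝔡).toRingHom fun _ hx =>
    (ker_tensorQuotient k 𝔠 𝔡).ge (h hx)).comp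
    (AdicCompletion.evalₐ (tensorIdeal k 𝔞 𝔟) m).toRingHom

section toQuotient

variable {𝔞 𝔠 : Ideal A} {𝔟 𝔡 : Ideal B} {m : ℕ}
  (h : tensorIdeal k 𝔞 𝔟 ^ m ≤ tensorIdeal k 𝔠 𝔡)

theorem toQuotient_ofTensor (t : A ⊗[k] B) :
    toQuotient k 𝔞 𝔠 𝔟 𝔡 m h (ofTensor k 𝔞 𝔟 t) = tensorQuotient k 𝔠 𝔡 t := by
  have : AdicCompletion.evalₐ (tensorIdeal k 𝔞 𝔟) m (ofTensor k 𝔞 𝔟 t) =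
      Ideal.Quotient.mk _ t := (AdicCompletion.evalₐ (tensorIdeal k 𝔞 𝔟) m).commutes t
  rw [toQuotient, RingHom.comp_apply]
  exact congrArg (Ideal.Quotient.lift _ (tensorQuotient k 𝔠 𝔡).toRingHom _) this

theorem toQuotient_inl (a : A) : toQuotient k 𝔞 𝔠 𝔟 𝔡 m h (inl k 𝔞 𝔟 a) =
    Ideal.Quotient.mk 𝔠 a ⊗ₜ 1 :=
  toQuotient_ofTensor k h _

theorem toQuotient_inr (b : B) : toQuotient k 𝔞 𝔠 𝔟 𝔡 m h (inr k 𝔞 𝔟 b) =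
    1 ⊗ₜ Ideal.Quotient.mk 𝔡 b :=
  toQuotient_ofTensor k h _

theorem toQuotient_surjective : Function.Surjective (toQuotient k 𝔞 𝔠 𝔟 𝔡 m h) := fun y => by
  obtain ⟨t, rfl⟩ := tensorQuotient_surjective k 𝔠 𝔡 y
  exact ⟨_, toQuotient_ofTensor k h t⟩

theorem map_inl_le_ker_toQuotient :
    𝔠.map (inl k 𝔞 𝔟) ≤ RingHom.ker (toQuotient k 𝔞 𝔠 𝔟 𝔡 m h) := by
  rw [Ideal.map_le_iff_le_comap]
  intro a ha
  rw [Ideal.mem_comap, RingHom.mem_ker, toQuotient_inl, Ideal.Quotient.eq_zero_iff_mem.mpr ha,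
    TensorProduct.zero_tmul]

/-- Since `𝔯` is finitely generated, the kernel of `E → (A ⊗ B) ⧸ 𝔯 ^ m` is `𝔯 ^ m E`. So `e` agrees
modulo `𝔯 ^ m E` with some `t` in `A ⊗ B`, which reduces the claim to `ker_tensorQuotient`. -/
theorem ker_toQuotient_le [IsNoetherianRing A] [IsNoetherianRing B] :
    RingHom.ker (toQuotient k 𝔞 𝔠 𝔟 𝔡 m h) ≤ 𝔠.map (inl k 𝔞 𝔟) ⊔ 𝔡.map (inr k 𝔞 𝔟) := by
  intro e he
  rw [← map_ofTensor_tensorIdeal]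
  obtain ⟨t, ht⟩ := Ideal.Quotient.mk_surjective (AdicCompletion.evalₐ (tensorIdeal k 𝔞 𝔟) m e)
  have hsub : e - ofTensor k 𝔞 𝔟 t ∈
      (tensorIdeal k 𝔞 𝔟 ^ m).map (ofTensor k 𝔞 𝔟) := by
    have h0 : AdicCompletion.evalₐ (tensorIdeal k 𝔞 𝔟) m (e - ofTensor k 𝔞 𝔟 t) = 0 := by
      rw [map_sub, ← ht, sub_eq_zero]
      exact ((AdicCompletion.evalₐ (tensorIdeal k 𝔞 𝔟) m).commutes t).symm
    have h1 : e - ofTensor k 𝔞 𝔟 t ∈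
        (AdicCompletion.eval (tensorIdeal k 𝔞 𝔟) (A ⊗[k] B) m).ker := by
      rw [LinearMap.mem_ker, ← AdicCompletion.factor_evalₐ_eq_eval _ _ (by simp), h0, map_zero]
    rw [← AdicCompletion.pow_smul_top_eq_ker_eval (tensorIdeal_fg k 𝔞 𝔟)] at h1
    rw [Ideal.smul_top_eq_map] at h1
    exact h1
  have ht' : t ∈ tensorIdeal k 𝔠 𝔡 := by
    rw [← ker_tensorQuotient, RingHom.mem_ker, ← RingHom.mem_ker.mp he, toQuotient,
      RingHom.comp_apply]
    exact congrArg (Ideal.Quotient.lift _ (tensorQuotient k 𝔠 𝔡).toRingHom _) ht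
  rw [← sub_add_cancel e (ofTensor k 𝔞 𝔟 t)]
  exact add_mem (Ideal.map_mono h hsub) (Ideal.mem_map_of_mem _ ht')

end toQuotient

/-- `E` is complete for `𝔯E`, again because `𝔯` is finitely generated. -/
theorem map_tensorIdeal_le_jacobson [IsNoetherianRing A] [IsNoetherianRing B]
    (𝔞 : Ideal A) (𝔟 : Ideal B) :
    (tensorIdeal k 𝔞 𝔟).map (ofTensor k 𝔞 𝔟) ≤ Ideal.jacobson ⊥ :=
  have : IsAdicComplete ((tensorIdeal k 𝔞 𝔟).map (ofTensor k 𝔞 𝔟))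
      (CompletedTensorProduct k 𝔞 𝔟) :=
    (IsAdicComplete.map_algebraMap_iff _ _).mpr
      (AdicCompletion.isAdicComplete (tensorIdeal_fg k 𝔞 𝔟))
  IsAdicComplete.le_jacobson_bot _

theorem tensorIdeal_pow_le (𝔞 : Ideal A) (𝔟 : Ideal B) (i j : ℕ) :
    tensorIdeal k 𝔞 𝔟 ^ (i + j) ≤ tensorIdeal k (𝔞 ^ i) (𝔟 ^ j) := by
  simp only [extendLeft, extendRight, tensorIdeal, Ideal.map_pow]
  exact Ideal.sup_pow_add_le_pow_sup_pow

theorem tensorIdeal_mono {𝔞 𝔞' : Ideal A} {𝔟 𝔟' : Ideal B} (h𝔞 : 𝔞 ≤ 𝔞') (h𝔟 : 𝔟 ≤ 𝔟') :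
    tensorIdeal k 𝔞 𝔟 ≤ tensorIdeal k 𝔞' 𝔟' :=
  sup_le_sup (Ideal.map_mono h𝔞) (Ideal.map_mono h𝔟)

/-! ### The three assertions -/

variable [IsNoetherianRing A] [IsNoetherianRing B] (𝔞 : Ideal A) (𝔟 : Ideal B)

theorem flat_inl [IsNoetherianRing (CompletedTensorProduct k 𝔞 𝔟)] : (inl k 𝔞 𝔟).Flat := by
  have hmap := map_ofTensor_tensorIdeal k 𝔞 𝔞 𝔟 𝔟
  refine RingHom.Flat.of_flat_approximations _ 𝔞 ((tensorIdeal k 𝔞 𝔟).map (ofTensor k 𝔞 𝔟))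
    (map_tensorIdeal_le_jacobson k 𝔞 𝔟) (le_sup_left.trans hmap.ge)
    (fun n => toQuotient k 𝔞 (𝔞 ^ n) 𝔟 (𝔟 ^ n) (n + n) (tensorIdeal_pow_le k 𝔞 𝔟 n n))
    (fun n => toQuotient_surjective k _) (fun n => (ker_toQuotient_le k _).trans ?_)
    (fun n => algebraMap (A ⧸ 𝔞 ^ n) ((A ⧸ 𝔞 ^ n) ⊗[k] (B ⧸ 𝔟 ^ n)))
    (fun n => (RingHom.flat_algebraMap_iff).mpr inferInstance)
    (fun n a => (toQuotient_inl k _ a).symm)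
  rw [hmap, Ideal.map_pow, Ideal.map_pow]
  exact sup_le (Ideal.pow_right_mono le_sup_left n) (Ideal.pow_right_mono le_sup_right n)

theorem flat_inr_quotient [IsNoetherianRing (CompletedTensorProduct k 𝔞 𝔟)]
    {𝔞' : Ideal A} (h : 𝔞 ≤ 𝔞') :
    ((Ideal.Quotient.mk (𝔞'.map (inl k 𝔞 𝔟))).comp (inr k 𝔞 𝔟)).Flat := by
  have hle : ∀ n, tensorIdeal k 𝔞 𝔟 ^ (1 + n) ≤ tensorIdeal k 𝔞' (𝔟 ^ n) := fun n =>
    (tensorIdeal_pow_le k 𝔞 𝔟 1 n).trans (tensorIdeal_mono k (by rwa [pow_one]) le_rfl)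
  -- Here `ρ` is just the extension of `𝔟`, since `𝔞'` is killed in the target.
  refine RingHom.Flat.of_flat_approximations _ 𝔟 _ ?_ le_rfl
    (fun n => Ideal.Quotient.lift (𝔞'.map (inl k 𝔞 𝔟))
      (toQuotient k 𝔞 𝔞' 𝔟 (𝔟 ^ n) (1 + n) (hle n))
      fun _ hx => map_inl_le_ker_toQuotient k (hle n) hx)
    (fun n => Ideal.Quotient.lift_surjective_of_surjective _ _ (toQuotient_surjective k _))
    (fun n => ?_)
    (fun n => (Algebra.TensorProduct.includeRight :
      B ⧸ 𝔟 ^ n →ₐ[k] (A ⧸ 𝔞') ⊗[k] (B ⧸ 𝔟 ^ n)).toRingHom)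
    (fun n => ?_) (fun n b => (toQuotient_inr k (hle n) b).symm)
  · rw [← Ideal.map_map, Ideal.map_le_iff_le_comap]
    intro x hx
    have hx' := map_tensorIdeal_le_jacobson k 𝔞 𝔟
      ((map_ofTensor_tensorIdeal k 𝔞 𝔞 𝔟 𝔟).ge (Ideal.mem_sup_right hx))
    rw [Ideal.mem_comap, Ideal.mem_jacobson_bot]
    intro y
    obtain ⟨y, rfl⟩ := Ideal.Quotient.mk_surjective y
    simpa using (Ideal.mem_jacobson_bot.mp hx' y).map (Ideal.Quotient.mk (𝔞'.map (inl k 𝔞 𝔟)))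
  · intro x hx
    obtain ⟨e, rfl⟩ := Ideal.Quotient.mk_surjective x
    have he := Ideal.mem_map_of_mem (Ideal.Quotient.mk (𝔞'.map (inl k 𝔞 𝔟)))
      (ker_toQuotient_le k (hle n) hx)
    rwa [Ideal.map_sup, Ideal.map_quotient_self, bot_sup_eq, Ideal.map_map, Ideal.map_pow] at he
  -- Swapping the factors turns this into a base change of the flat `k`-module `A ⧸ 𝔞'`.
  · have := RingHom.Flat.comp (f := algebraMap (B ⧸ 𝔟 ^ n) ((B ⧸ 𝔟 ^ n) ⊗[k] (A ⧸ 𝔞')))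
      (g := (Algebra.TensorProduct.comm k (B ⧸ 𝔟 ^ n) (A ⧸ 𝔞')).toRingEquiv.toRingHom)
      ((RingHom.flat_algebraMap_iff).mpr inferInstance)
      (RingHom.Flat.of_bijective (AlgEquiv.bijective _))
    convert this
    ext b
    rfl

theorem isZariskiRing_of_faithfullyFlat_inl [TopologicalSpace A] (h𝔞 : IsAdic 𝔞)
    (h : (inl k 𝔞 𝔟).FaithfullyFlat) : IsZariskiRing A := by
  refine ⟨inferInstance, 𝔞, h𝔞, le_sInf ?_⟩
  rintro 𝔪 ⟨-, h𝔪⟩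
  obtain ⟨𝔭, h𝔭⟩ := (RingHom.FaithfullyFlat.iff_flat_and_comap_surjective.mp h).2 ⟨𝔪, h𝔪.isPrime⟩
  -- Enlarging `𝔭` to a maximal `𝔫` keeps the contraction `𝔪`, and `𝔫` contains the Jacobson
  -- radical, hence `𝔞E`.
  obtain ⟨𝔫, h𝔫, h𝔭𝔫⟩ := Ideal.exists_le_maximal 𝔭.asIdeal 𝔭.2.ne_top
  have hcomap : 𝔪 = 𝔫.comap (inl k 𝔞 𝔟) := by
    refine h𝔪.eq_of_le (Ideal.comap_ne_top _ h𝔫.ne_top) ?_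
    rw [← show 𝔭.asIdeal.comap (inl k 𝔞 𝔟) = 𝔪 from congrArg PrimeSpectrum.asIdeal h𝔭]
    exact Ideal.comap_mono h𝔭𝔫
  rw [hcomap, ← Ideal.map_le_iff_le_comap]
  refine le_trans ?_ ((map_tensorIdeal_le_jacobson k 𝔞 𝔟).trans (sInf_le ⟨bot_le, h𝔫⟩))
  rw [map_ofTensor_tensorIdeal]
  exact le_sup_left

theorem faithfullyFlat_inl [IsNoetherianRing (CompletedTensorProduct k 𝔞 𝔟)]
    [TopologicalSpace A] (h𝔞 : IsAdic 𝔞) (h𝔟 : 𝔟 ≠ ⊤) (hA : IsZariskiRing A) :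
    (inl k 𝔞 𝔟).FaithfullyFlat := by
  refine .of_flat_of_map_ne_top (flat_inl k 𝔞 𝔟) fun 𝔪 h𝔪 htop => ?_
  have h : tensorIdeal k 𝔞 𝔟 ^ 1 ≤ tensorIdeal k 𝔪 𝔟 := by
    rw [pow_one]
    exact tensorIdeal_mono k (hA.le_of_isMaximal h𝔞 h𝔪) le_rfl
  have : Nontrivial (A ⧸ 𝔪) := Ideal.Quotient.nontrivial_iff.mpr h𝔪.ne_top
  have : Nontrivial (B ⧸ 𝔟) := Ideal.Quotient.nontrivial_iff.mpr h𝔟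
  have h1 : (1 : CompletedTensorProduct k 𝔞 𝔟) ∈ 𝔪.map (inl k 𝔞 𝔟) := htop.ge trivial
  have h2 := map_inl_le_ker_toQuotient k h h1
  rw [RingHom.mem_ker, map_one] at h2
  exact one_ne_zero h2

end CompletedTensorProduct

theorem theorem3p1 {k A B : Type*} [Field k] [CommRing A] [CommRing B]
    [Algebra k A] [Algebra k B] [TopologicalSpace A] [TopologicalSpace B]
    [IsNoetherianRing A] [IsNoetherianRing B]
    (𝔞 : Ideal A) (𝔟 : Ideal B) (h𝔞 : IsAdic 𝔞) (h𝔟 : IsAdic 𝔟)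
    (hE : IsNoetherianRing (CompletedTensorProduct k 𝔞 𝔟)) :
    (CompletedTensorProduct.inl k 𝔞 𝔟).Flat ∧
    (((CompletedTensorProduct.inl k 𝔞 𝔟).FaithfullyFlat → IsZariskiRing A) ∧
      (𝔟 ≠ ⊤ → IsZariskiRing A → (CompletedTensorProduct.inl k 𝔞 𝔟).FaithfullyFlat)) ∧
    (∀ 𝔞' : Ideal A, 𝔞 ≤ 𝔞' →
      ((Ideal.Quotient.mk (𝔞'.map (CompletedTensorProduct.inl k 𝔞 𝔟))).comp
        (CompletedTensorProduct.inr k 𝔞 𝔟)).Flat) := by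
  exact ⟨CompletedTensorProduct.flat_inl k 𝔞 𝔟,
    ⟨CompletedTensorProduct.isZariskiRing_of_faithfullyFlat_inl k 𝔞 𝔟 h𝔞,
      CompletedTensorProduct.faithfullyFlat_inl k 𝔞 𝔟 h𝔞⟩,
    fun _ => CompletedTensorProduct.flat_inr_quotient k 𝔞 𝔟⟩
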